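/- Let $n,k$ be integers with $1\le k<\lfloor n/2\rfloor$, and let $G=C_n^k$ be the power of cycle, i.e. the simple graph with vertex set $\mathbb{Z}/n\mathbb{Z}$ in which two distinct vertices $x,y$ are adjacent if and only if $x-y\equiv\pm d\pmod n$ for some $1\le d\le k$. Let $\Delta(G)$ be its maximum degree. Let $\chi''(G)$ be its total chromatic number, the least number of colours in a colouring of the vertices and edges of $G$ in which adjacent vertices, distinct edges with a common endpoint, and edges and their endpoints always receive different colours. Suppose that $k+i$ divides $n$ for some integer $i$ with $1\le i\le k+1$. Then $\chi''(G)\le\Delta(G)+2$, that is, $G$ satisfies the Total Coloring Conjecture. If moreover $n$ is even and $k+i$ is odd, then $G$ is of type I, that is, $\chi''(G)=\Delta(G)+1$. -/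

import Mathlib

namespace SimpleGraph

/-- `c` colours the elements (vertices and edges) of `G` so that adjacent vertices, distinct edges
with a common endpoint, and edges and their endpoints receive different colours. -/
structure IsTotalColoring {V α : Type*} (G : SimpleGraph V) (c : V ⊕ G.edgeSet → α) : Prop where
  vertex_ne : ∀ u v : V, G.Adj u v → c (Sum.inl u) ≠ c (Sum.inl v)
  edge_ne : ∀ (e f : G.edgeSet) (v : V), e ≠ f → v ∈ (e : Sym2 V) → v ∈ (f : Sym2 V) →
    c (Sum.inr e) ≠ c (Sum.inr f)
  incident_ne : ∀ (v : V) (e : G.edgeSet), v ∈ (e : Sym2 V) → c (Sum.inl v) ≠ c (Sum.inr e)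

/-- `G` has a total colouring with (at most) `m` colours. -/
def TotalColorable {V : Type*} (G : SimpleGraph V) (m : ℕ) : Prop :=
  ∃ c : V ⊕ G.edgeSet → Fin m, G.IsTotalColoring c

/-- The total chromatic number `χ''(G)`: the least number of colours of a total colouring
(`⊤` if no finite number suffices). -/
noncomputable def totalChromaticNumber {V : Type*} (G : SimpleGraph V) : ℕ∞ :=
  ⨅ m ∈ {m : ℕ | G.TotalColorable m}, (m : ℕ∞)

/-- The power of cycle `C_n^k`: the circulant graph on `ℤ/nℤ` whose connection set is
`{±1, ±2, …, ±k}`. -/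
def powerOfCycle (n k : ℕ) : SimpleGraph (ZMod n) :=
  circulantGraph {s : ZMod n | ∃ d : ℕ, 1 ≤ d ∧ d ≤ k ∧ (s = (d : ZMod n) ∨ s = -(d : ZMod n))}

end SimpleGraph

/-!
Write `m = k + i`, so that `k < m ≤ 2k + 1` and `m ∣ n`. Since `2k < n`, the graph is `2k`-regular,
and an edge is a chord `{x, x + d}` with a unique `x` and a unique length `1 ≤ d ≤ k`; the
bookkeeping for colourings given by chords is `IsChordTotalColoring`. Reduction modulo `m` maps the
graph to `K_m`. A total colouring of `K_m` lifts to the vertices, which stay properly coloured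
because `k < m`, and to chords of lengths representing the nonzero residues up to sign. The
remaining chords form a circulant graph, which is edge coloured with new colours.

* For odd `m`, the total colouring of `K_m` by sums modulo `m` has `m` colours and leaves
  `(2k + 1 - m) / 2` lengths. The representatives are free to choose between `d` and `m - d`, exactly
  one of which is odd. If `n` is even, leaving odd lengths makes the rest bipartite by parity, two
  colours for each length suffice, and the total is `2k + 1`
  (`totalColorable_powerOfCycle_of_even_of_odd`). In general Vizing's theorem
  (`exists_isEdgeColoring`) costs one more colour (`totalColorable_powerOfCycle_of_odd`).
* For even `m = 2h`, the length `h` is its own negative modulo `m`. If `h` is odd, the sums modulo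
  `m` colour everything but the lengths `h, …, k` with `m` colours
  (`exists_isChordTotalColoring_of_odd_half`). If `h` is even, the sums modulo `m + 1`, together
  with one more colour, take care of the lengths `1, …, h` (`exists_isChordTotalColoring_half`). In
  both cases the lengths left over form an interval that starts with an odd number, and the
  circulant graph on an even number of vertices with this connection set is of class 1
  (`exists_isChordColoring_Icc`), because two consecutive lengths, the larger one even, need only
  four colours (`exists_isChordColoring_pair`). The total is `2k + 2`.

A vertex of maximum degree `Δ` and its edges need `Δ + 1` colours, which gives the lower bound.
-/

namespace SimpleGraph

/-! ### Vizing's theorem -/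

section Vizing

variable {V κ : Type*}

/-- `c` is a proper edge colouring of `G`; its values off the edge set of `G` are irrelevant. -/
def IsEdgeColoring (G : SimpleGraph V) (c : Sym2 V → κ) : Prop :=
  ∀ ⦃v w w' : V⦄, G.Adj v w → G.Adj v w' → c s(v, w) = c s(v, w') → w = w'

/-- The colour `a` occurs on no edge of `G` at `v`. -/
def Misses (G : SimpleGraph V) (c : Sym2 V → κ) (v : V) (a : κ) : Prop :=
  ∀ w, G.Adj v w → c s(v, w) ≠ a

/-- Under two involutions `A`, `B`, an orbit containing a fixed point of `A` contains at most one
fixed point of `B`: an alternating path has only two ends. The orbit consists of the points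
`(A * B) ^ i` applied to the fixed point of `A`, and `A`, `B` act on the exponents as
`i ↦ -i` and `i ↦ -i - 1`. -/
lemma eq_of_fixed_by_involutions {A B : Equiv.Perm V} (hA : ∀ v, A (A v) = v)
    (hB : ∀ v, B (B v) = v) {x u w : V} (hx : A x = x) (hu : B u = u) (hw : B w = w)
    (hxu : Relation.ReflTransGen (fun p q => q = A p ∨ q = B p) x u)
    (hxw : Relation.ReflTransGen (fun p q => q = A p ∨ q = B p) x w) : u = w := by
  set σ : Equiv.Perm V := A * B with hσ
  have hA1 : A * A = 1 := Equiv.ext hA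
  have hB1 : B * B = 1 := Equiv.ext hB
  have hAi : A⁻¹ = A := inv_eq_of_mul_eq_one_left hA1
  have hBi : B⁻¹ = B := inv_eq_of_mul_eq_one_left hB1
  have hAσ : ∀ i : ℤ, A ((σ ^ i) x) = (σ ^ (-i)) x := by
    intro i
    have h1 : A * σ * A⁻¹ = σ⁻¹ := by
      rw [hσ, mul_inv_rev, hAi, hBi, ← mul_assoc, hA1, one_mul]
    have h2 : A * σ ^ i * A⁻¹ = σ ^ (-i) := by
      rw [← conj_zpow, h1, inv_zpow']
    calc A ((σ ^ i) x) = (A * σ ^ i * A⁻¹) (A x) := by simp [Equiv.Perm.mul_apply]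
      _ = (σ ^ (-i)) x := by rw [h2, hx]
  have hBσ : ∀ i : ℤ, B ((σ ^ i) x) = (σ ^ (-(1 + i))) x := by
    intro i
    rw [← hAσ, zpow_add, zpow_one, Equiv.Perm.mul_apply, hσ, Equiv.Perm.mul_apply, hA]
  have key : ∀ v, Relation.ReflTransGen (fun p q => q = A p ∨ q = B p) x v →
      ∃ i : ℤ, v = (σ ^ i) x := by
    intro v hv
    induction hv with
    | refl => exact ⟨0, rfl⟩
    | tail _ h ih =>
      obtain ⟨i, rfl⟩ := ih
      rcases h with rfl | rfl
      · exact ⟨_, hAσ i⟩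
      · exact ⟨_, hBσ i⟩
  obtain ⟨i, rfl⟩ := key u hxu
  obtain ⟨j, rfl⟩ := key w hxw
  have hfix : ∀ i : ℤ, B ((σ ^ i) x) = (σ ^ i) x → σ ^ (2 * i + 1) ∈ MulAction.stabilizer _ x := by
    intro i hi
    rw [hBσ] at hi
    rw [MulAction.mem_stabilizer_iff, Equiv.Perm.smul_def]
    have : (σ ^ (2 * i + 1)) x = (σ ^ (i + 1)) ((σ ^ i) x) := by
      rw [← Equiv.Perm.mul_apply, ← zpow_add]; congr 2; ring
    rw [this, ← hi, ← Equiv.Perm.mul_apply, ← zpow_add,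
      show i + 1 + -(1 + i) = 0 by ring, zpow_zero, Equiv.Perm.one_apply]
  -- The exponents fixing `x` form a subgroup; it contains `2i+1` and `2j+1`, hence `i-j`.
  have hi := hfix i hu
  have hj := hfix j hw
  have hij : σ ^ (i - j) ∈ MulAction.stabilizer (Equiv.Perm V) x := by
    have : σ ^ (i - j)
        = (σ ^ (2 * i + 1)) ^ (i - j) * ((σ ^ (2 * i + 1)) ^ (-i) * (σ ^ (2 * j + 1)) ^ i) := by
      rw [← zpow_mul, ← zpow_mul, ← zpow_mul, ← zpow_add, ← zpow_add]
      congr 1; ring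
    rw [this]
    exact mul_mem (zpow_mem hi _) (mul_mem (zpow_mem hi _) (zpow_mem hj _))
  rw [MulAction.mem_stabilizer_iff, Equiv.Perm.smul_def] at hij
  calc (σ ^ i) x = (σ ^ j) ((σ ^ (i - j)) x) := by
        rw [← Equiv.Perm.mul_apply, ← zpow_add]; congr 2; ring
    _ = (σ ^ j) x := by rw [hij]

/-- The matching formed by the edges of one colour, as an involution of the vertices. -/
lemma IsEdgeColoring.exists_involution {G : SimpleGraph V} {c : Sym2 V → κ}
    (hc : G.IsEdgeColoring c) (a : κ) :
    ∃ A : Equiv.Perm V, (∀ v, A (A v) = v) ∧ (∀ v w, G.Adj v w → c s(v, w) = a → A v = w) ∧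
      ∀ v, G.Misses c v a → A v = v := by
  classical
  let f : V → V := fun v => if h : ∃ w, G.Adj v w ∧ c s(v, w) = a then h.choose else v
  have f1 : ∀ v w, G.Adj v w → c s(v, w) = a → f v = w := by
    intro v w h1 h2
    have h : ∃ w, G.Adj v w ∧ c s(v, w) = a := ⟨w, h1, h2⟩
    have : f v = h.choose := dif_pos h
    rw [this]
    exact hc h.choose_spec.1 h1 (h.choose_spec.2.trans h2.symm)
  have f2 : ∀ v, G.Misses c v a → f v = v := by
    intro v hv
    exact dif_neg fun ⟨w, h1, h2⟩ => hv w h1 h2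
  have f3 : Function.Involutive f := by
    intro v
    by_cases h : ∃ w, G.Adj v w ∧ c s(v, w) = a
    · obtain ⟨w, h1, h2⟩ := h
      rw [f1 v w h1 h2, f1 w v h1.symm (by rw [Sym2.eq_swap, h2])]
    · have : f v = v := dif_neg h
      rw [this, this]
  exact ⟨f3.toPerm, f3, f1, f2⟩

/-- Kempe change: the colours `a` and `b` can be exchanged on a component of the subgraph they
form. If `x` misses `a` and the distinct vertices `u`, `w` miss `b`, then the component of one of
`u`, `w` avoids `x`. -/
lemma IsEdgeColoring.exists_kempe [DecidableEq κ] {G : SimpleGraph V} {c : Sym2 V → κ}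
    (hc : G.IsEdgeColoring c) {a b : κ} {x u w : V} (hx : G.Misses c x a) (hu : G.Misses c u b)
    (hw : G.Misses c w b) (huw : u ≠ w) :
    ∃ (C : Set V) (c' : Sym2 V → κ), x ∉ C ∧ (u ∈ C ∨ w ∈ C) ∧ G.IsEdgeColoring c' ∧
      (∀ v ∉ C, ∀ z, G.Adj v z → c' s(v, z) = c s(v, z)) ∧
      (∀ v ∈ C, ∀ z, G.Adj v z → c' s(v, z) = Equiv.swap a b (c s(v, z))) := by
  classical
  obtain ⟨A, hA, hA1, hA2⟩ := hc.exists_involution a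
  obtain ⟨B, hB, hB1, hB2⟩ := hc.exists_involution b
  let R : V → V → Prop := fun p q => q = A p ∨ q = B p
  have hsymm : ∀ p q, Relation.ReflTransGen R p q → Relation.ReflTransGen R q p := by
    intro p q h
    induction h with
    | refl => exact .refl
    | tail _ h ih =>
      refine Relation.ReflTransGen.head ?_ ih
      rcases h with rfl | rfl
      · exact Or.inl (hA _).symm
      · exact Or.inr (hB _).symm
  have key : ∀ t, ¬ Relation.ReflTransGen R t x → (t = u ∨ t = w) →
      ∃ (C : Set V) (c' : Sym2 V → κ), x ∉ C ∧ (u ∈ C ∨ w ∈ C) ∧ G.IsEdgeColoring c' ∧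
      (∀ v ∉ C, ∀ z, G.Adj v z → c' s(v, z) = c s(v, z)) ∧
      (∀ v ∈ C, ∀ z, G.Adj v z → c' s(v, z) = Equiv.swap a b (c s(v, z))) := by
    intro t ht htuw
    let C : Set V := {v | Relation.ReflTransGen R t v}
    let c' : Sym2 V → κ := fun e => if ∃ v ∈ e, v ∈ C then Equiv.swap a b (c e) else c e
    have hC : ∀ v z, G.Adj v z → c s(v, z) = a ∨ c s(v, z) = b → v ∈ C → z ∈ C := by
      intro v z h h' hv
      refine Relation.ReflTransGen.tail hv ?_
      rcases h' with h' | h'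
      · exact Or.inl (hA1 v z h h').symm
      · exact Or.inr (hB1 v z h h').symm
    have c1 : ∀ v ∈ C, ∀ z, G.Adj v z → c' s(v, z) = Equiv.swap a b (c s(v, z)) := by
      intro v hv z _
      exact if_pos ⟨v, Sym2.mem_mk_left _ _, hv⟩
    have c2 : ∀ v ∉ C, ∀ z, G.Adj v z → c' s(v, z) = c s(v, z) := by
      intro v hv z h
      by_cases hz : z ∈ C
      · have h0 : c' s(v, z) = Equiv.swap a b (c s(v, z)) :=
          if_pos ⟨z, Sym2.mem_mk_right _ _, hz⟩
        rw [h0]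
        apply Equiv.swap_apply_of_ne_of_ne
        · exact fun h' => hv (hC z v h.symm (Or.inl (by rw [Sym2.eq_swap, h'])) hz)
        · exact fun h' => hv (hC z v h.symm (Or.inr (by rw [Sym2.eq_swap, h'])) hz)
      · refine if_neg ?_
        rintro ⟨y, hy, hyC⟩
        rcases Sym2.mem_iff.1 hy with rfl | rfl
        · exact hv hyC
        · exact hz hyC
    refine ⟨C, c', ht, ?_, ?_, c2, c1⟩
    · rcases htuw with rfl | rfl
      · exact Or.inl .refl
      · exact Or.inr .refl
    · intro v z z' hz hz' h
      by_cases hv : v ∈ C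
      · rw [c1 v hv z hz, c1 v hv z' hz'] at h
        exact hc hz hz' ((Equiv.swap a b).injective h)
      · rw [c2 v hv z hz, c2 v hv z' hz'] at h
        exact hc hz hz' h
  by_cases h1 : Relation.ReflTransGen R u x
  · by_cases h2 : Relation.ReflTransGen R w x
    · exact absurd (eq_of_fixed_by_involutions hA hB (hA2 x hx) (hB2 u hu) (hB2 w hw)
        (hsymm _ _ h1) (hsymm _ _ h2)) huw
    · exact key w h2 (Or.inr rfl)
  · exact key u h1 (Or.inl rfl)

/-- A step of a fan at `x`: the colour of the edge `xz` is missing at `v`. -/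
def FanStep (G : SimpleGraph V) (c : Sym2 V → κ) (x v z : V) : Prop :=
  G.Adj x z ∧ G.Misses c v (c s(x, z))

/-- Let `y` be a non-neighbour of `x`. If a fan at `x` leads from `y` to a vertex missing a colour
that `x` misses too, then recolouring along the fan makes `x` and `y` miss a common colour. The
fan is consumed from its far end. -/
lemma IsEdgeColoring.exists_common_missing {G : SimpleGraph V} {x y : V} (hxy : ¬ G.Adj x y)
    (l : ℕ) : ∀ (c : Sym2 V → κ) (a : κ) (f : ℕ → V), G.IsEdgeColoring c → f 0 = y →
      (∀ j < l, G.FanStep c x (f j) (f (j + 1))) → G.Misses c x a → G.Misses c (f l) a →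
      ∃ (c' : Sym2 V → κ) (a' : κ), G.IsEdgeColoring c' ∧ G.Misses c' x a' ∧ G.Misses c' y a' := by
  classical
  induction l using Nat.strong_induction_on with
  | _ l ih =>
  intro c a f hc hf hstep hxa hla
  rcases Nat.eq_zero_or_pos l with rfl | hl
  · exact ⟨c, a, hc, hxa, hf ▸ hla⟩
  obtain ⟨r, rfl⟩ : ∃ r, l = r + 1 := ⟨l - 1, by omega⟩
  by_cases hrep : ∃ j < r + 1, f j = f (r + 1)
  · obtain ⟨j, hj, hfj⟩ := hrep
    exact ih j hj c a f hc hf (fun i hi => hstep i (hi.trans hj)) hxa (hfj ▸ hla)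
  push Not at hrep
  set u := f (r + 1) with hu
  obtain ⟨hxu, hmiss⟩ := hstep r (by omega)
  rw [← hu] at hxu hmiss
  have hne : ∀ {v z : V}, v ≠ x → v ≠ u → s(v, z) ≠ s(x, u) := by
    intro v z h1 h2 h
    rcases Sym2.eq_iff.1 h with ⟨h, -⟩ | ⟨h, -⟩
    · exact h1 h
    · exact h2 h
  have hne' : ∀ {v z : V}, z ≠ x → z ≠ u → s(v, z) ≠ s(x, u) := by
    intro v z h1 h2
    rw [Sym2.eq_swap]; exact hne h1 h2
  let c' : Sym2 V → κ := Function.update c s(x, u) a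
  have c'xu : c' s(x, u) = a := Function.update_self ..
  have c'ne : ∀ e, e ≠ s(x, u) → c' e = c e := fun e he => Function.update_of_ne he ..
  have hxne : x ≠ u := hxu.ne
  -- `a` is missing at both ends of the recoloured edge
  have hc' : G.IsEdgeColoring c' := by
    intro v z z' hz hz' h
    by_cases e1 : s(v, z) = s(x, u) <;> by_cases e2 : s(v, z') = s(x, u)
    · exact Sym2.congr_right.1 (e1.trans e2.symm)
    · rw [e1, c'xu, c'ne _ e2] at h
      rcases Sym2.eq_iff.1 e1 with ⟨rfl, rfl⟩ | ⟨rfl, rfl⟩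
      · exact absurd h.symm (hxa _ hz')
      · exact absurd h.symm (hla _ hz')
    · rw [e2, c'xu, c'ne _ e1] at h
      rcases Sym2.eq_iff.1 e2 with ⟨rfl, rfl⟩ | ⟨rfl, rfl⟩
      · exact absurd h (hxa _ hz)
      · exact absurd h (hla _ hz)
    · rw [c'ne _ e1, c'ne _ e2] at h
      exact hc hz hz' h
  have hfx : ∀ j ≤ r, f j ≠ x := by
    intro j hj h
    have := (hstep j (by omega)).2 (f (j + 1)) (h ▸ (hstep j (by omega)).1)
    rw [h] at this
    exact this rfl
  refine ih r (by omega) c' (c s(x, u)) f hc' hf ?_ ?_ ?_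
  · intro j hj
    obtain ⟨h1, h2⟩ := hstep j (by omega)
    refine ⟨h1, ?_⟩
    have e : s(x, f (j + 1)) ≠ s(x, u) := fun h => hrep _ (by omega) (Sym2.congr_right.1 h)
    rw [c'ne _ e]
    intro z hz
    rw [c'ne _ (hne (hfx j (by omega)) (hrep j (by omega)))]
    exact h2 z hz
  · intro z hz
    by_cases hzu : z = u
    · subst hzu
      rw [c'xu]; exact (hxa _ hxu).symm
    · rw [c'ne _ fun h => hzu (Sym2.congr_right.1 h)]
      exact fun h => hzu (hc hz hxu h)
  · intro z hz
    rw [c'ne _ (hne (hfx r le_rfl) (hrep r (by omega)))]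
    exact hmiss z hz

/-- If `x` and `y` are not adjacent and every vertex misses a colour, then `c` can be changed so
that `x` and `y` miss a common colour. -/
lemma IsEdgeColoring.exists_common_missing' [Finite V] {G : SimpleGraph V} {x y : V}
    (hxy : ¬ G.Adj x y) {c : Sym2 V → κ} (hc : G.IsEdgeColoring c)
    (hmiss : ∀ v, ∃ a, G.Misses c v a) :
    ∃ (c' : Sym2 V → κ) (a' : κ), G.IsEdgeColoring c' ∧ G.Misses c' x a' ∧ G.Misses c' y a' := by
  classical
  have := Fintype.ofFinite V
  -- the previous lemma, with reachability in place of a sequence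
  have finish : ∀ (c : Sym2 V → κ), G.IsEdgeColoring c → ∀ u a,
      Relation.ReflTransGen (G.FanStep c x) y u → G.Misses c x a → G.Misses c u a →
      ∃ (c' : Sym2 V → κ) (a' : κ), G.IsEdgeColoring c' ∧ G.Misses c' x a' ∧ G.Misses c' y a' := by
    intro c hc u a hu hxa hua
    have : ∃ (l : ℕ) (f : ℕ → V), f 0 = y ∧ f l = u ∧
        ∀ j < l, G.FanStep c x (f j) (f (j + 1)) := by
      clear hua
      induction hu with
      | refl => exact ⟨0, fun _ => y, rfl, rfl, by simp⟩
      | @tail v z _ h ih =>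
        obtain ⟨l, f, h0, hl, hf⟩ := ih
        refine ⟨l + 1, Function.update f (l + 1) z, ?_, by simp, ?_⟩
        · rw [Function.update_of_ne (by omega), h0]
        · intro j hj
          rw [Function.update_of_ne (by omega)]
          rcases Nat.lt_succ_iff_lt_or_eq.1 hj with h' | rfl
          · rw [Function.update_of_ne (by omega)]; exact hf j h'
          · rw [Function.update_self, hl]; exact h
    obtain ⟨l, f, h0, rfl, hf⟩ := this
    exact exists_common_missing hxy l c a f hc h0 hf hxa hua
  by_contra hcon
  choose b hb using hmiss
  let R : Finset V := Finset.univ.filter fun v => Relation.ReflTransGen (G.FanStep c x) y v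
  have hR : ∀ v, v ∈ R ↔ Relation.ReflTransGen (G.FanStep c x) y v := by simp [R]
  have hnext : ∀ v ∈ R, ∃ z, G.Adj x z ∧ c s(x, z) = b v := by
    intro v hv
    by_contra hz
    push Not at hz
    exact hcon (finish c hc v (b v) ((hR v).1 hv) hz (hb v))
  choose! g hg using hnext
  -- Each vertex of the closed fan misses the colour of an edge from `x` to the fan, but `xy` is
  -- not such an edge, so two vertices miss the same colour.
  obtain ⟨u, hu, w, hw, huw, hguw⟩ : ∃ u ∈ R, ∃ w ∈ R, u ≠ w ∧ g u = g w := by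
    apply Finset.exists_ne_map_eq_of_card_lt_of_maps_to (t := R.erase y)
    · exact Finset.card_erase_lt_of_mem ((hR y).2 .refl)
    · intro v hv
      obtain ⟨h1, h2⟩ := hg v hv
      refine Finset.mem_coe.2 (Finset.mem_erase.2 ⟨fun h => hxy (h ▸ h1), ?_⟩)
      exact (hR _).2 (((hR v).1 hv).tail ⟨h1, h2 ▸ hb v⟩)
  have hbuw : b u = b w := by rw [← (hg u hu).2, ← (hg w hw).2, hguw]
  obtain ⟨C, c', hxC, hC, hc', h1, h2⟩ :=
    hc.exists_kempe (hb x) (hb u) (hbuw ▸ hb w) huw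
  obtain ⟨t, htR, htC, htb⟩ : ∃ t, t ∈ R ∧ t ∈ C ∧ G.Misses c t (b u) := by
    rcases hC with h | h
    · exact ⟨u, hu, h, hb u⟩
    · exact ⟨w, hw, h, hbuw ▸ hb w⟩
  have hx' : G.Misses c' x (b x) := by
    intro z hz
    rw [h1 x hxC z hz]; exact hb x z hz
  have hmC : ∀ v ∈ C, G.Misses c v (b u) → G.Misses c' v (b x) := by
    intro v hv hm z hz h
    rw [h2 v hv z hz] at h
    refine hm z hz ?_
    have := congrArg (Equiv.swap (b x) (b u)) h
    rwa [Equiv.swap_apply_self, Equiv.swap_apply_left] at this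
  -- The fan survives the exchange up to the first vertex that now misses the colour `b x`.
  have hwalk : ∀ v, Relation.ReflTransGen (G.FanStep c x) y v →
      Relation.ReflTransGen (G.FanStep c' x) y v ∨
      ∃ s, Relation.ReflTransGen (G.FanStep c' x) y s ∧ G.Misses c' s (b x) := by
    intro v hv
    induction hv with
    | refl => exact Or.inl .refl
    | @tail v z _ h ih =>
      rcases ih with ih | ih
      · obtain ⟨hz, hvz⟩ := h
        by_cases hvC : v ∈ C
        · by_cases hcol : c s(x, z) = b u
          · exact Or.inr ⟨v, ih, hmC v hvC (hcol ▸ hvz)⟩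
          · refine Or.inl (ih.tail ⟨hz, ?_⟩)
            rw [h1 x hxC z hz]
            intro s hs h
            rw [h2 v hvC s hs] at h
            refine hvz s hs ?_
            have := congrArg (Equiv.swap (b x) (b u)) h
            rwa [Equiv.swap_apply_self, Equiv.swap_apply_of_ne_of_ne (hb x z hz) hcol] at this
        · refine Or.inl (ih.tail ⟨hz, ?_⟩)
          rw [h1 x hxC z hz]
          intro s hs
          rw [h1 v hvC s hs]; exact hvz s hs
      · exact Or.inr ih
  rcases hwalk t ((hR t).1 htR) with h | ⟨s, hs, hs'⟩
  · exact hcon (finish c' hc' t _ h hx' (hmC t htC htb))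
  · exact hcon (finish c' hc' s _ hs hx' hs')

/-- **Vizing's theorem**: a finite graph with all degrees at most `D` has a proper edge colouring
with `D + 1` colours. -/
theorem exists_isEdgeColoring [Finite V] (D : ℕ) (G : SimpleGraph V)
    (hG : ∀ v, (G.neighborSet v).ncard ≤ D) :
    ∃ c : Sym2 V → Fin (D + 1), G.IsEdgeColoring c := by
  classical
  induction G using WellFoundedLT.induction with
  | _ G ih =>
  by_cases hbot : ∃ x y, G.Adj x y
  · obtain ⟨x, y, hxy⟩ := hbot
    let H := G.deleteEdges {s(x, y)}
    have hHle : H ≤ G := deleteEdges_le _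
    have hHxy : ¬ H.Adj x y := by simp [H, deleteEdges_adj]
    have hlt : H < G := lt_of_le_of_ne hHle fun h => hHxy (h ▸ hxy)
    have hHdeg : ∀ v, (H.neighborSet v).ncard ≤ D := fun v =>
      (Set.ncard_le_ncard (fun w hw => hHle hw)).trans (hG v)
    obtain ⟨c, hc⟩ := ih H hlt hHdeg
    have hmiss : ∀ v, ∃ a, H.Misses c v a := by
      intro v
      by_contra hcon
      have hsurj : (fun w => c s(v, w)) '' H.neighborSet v = Set.univ := by
        refine Set.eq_univ_of_forall fun a => ?_
        by_contra ha
        exact hcon ⟨a, fun w hw h => ha ⟨w, hw, h⟩⟩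
      have h1 := Set.ncard_image_le (f := fun w => c s(v, w)) (H.neighborSet v).toFinite
      rw [hsurj, Set.ncard_univ, Nat.card_eq_fintype_card, Fintype.card_fin] at h1
      have := hHdeg v
      omega
    obtain ⟨c', a, hc', hxa, hya⟩ := hc.exists_common_missing' hHxy hmiss
    refine ⟨Function.update c' s(x, y) a, ?_⟩
    have hH : ∀ {v z}, G.Adj v z → s(v, z) ≠ s(x, y) → H.Adj v z := by
      intro v z h hne
      simp only [H, deleteEdges_adj]
      exact ⟨h, hne⟩
    intro v z z' hz hz' h
    by_cases e1 : s(v, z) = s(x, y) <;> by_cases e2 : s(v, z') = s(x, y)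
    · exact Sym2.congr_right.1 (e1.trans e2.symm)
    · rw [e1, Function.update_self, Function.update_of_ne e2] at h
      rcases Sym2.eq_iff.1 e1 with ⟨rfl, rfl⟩ | ⟨rfl, rfl⟩
      · exact absurd h.symm (hxa _ (hH hz' e2))
      · exact absurd h.symm (hya _ (hH hz' e2))
    · rw [e2, Function.update_self, Function.update_of_ne e1] at h
      rcases Sym2.eq_iff.1 e2 with ⟨rfl, rfl⟩ | ⟨rfl, rfl⟩
      · exact absurd h (hxa _ (hH hz e1))
      · exact absurd h (hya _ (hH hz e1))
    · rw [Function.update_of_ne e1, Function.update_of_ne e2] at h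
      exact hc' (hH hz e1) (hH hz' e2) h
  · exact ⟨fun _ => 0, fun v w _ h => absurd ⟨v, w, h⟩ hbot⟩

end Vizing
/-! ### Colouring powers of cycles by chords -/

section Chords

variable {n : ℕ}

/-- The colours of the chords at `v`, where `F d x` is the colour of the chord `{x, x + d}`:
`(d, true)` stands for `{v, v + d}` and `(d, false)` for `{v - d, v}`. -/
def chordsAt (F : ℕ → ZMod n → ℕ) (v : ZMod n) (p : ℕ × Bool) : ℕ :=
  if p.2 then F p.1 v else F p.1 (v - p.1)

/-- `F` colours the chords `{x, x + d}`, `d ∈ S`, properly with colours below `M`. Chords with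
different descriptions `(x, d)` count as different. -/
def IsChordColoring (S : Set ℕ) (M : ℕ) (F : ℕ → ZMod n → ℕ) : Prop :=
  (∀ d ∈ S, ∀ v, F d v < M) ∧ ∀ v, Set.InjOn (chordsAt F v) {p | p.1 ∈ S}

/-- `f` and `F` colour the vertices and the chords with lengths in `S` with colours below `M`, in
such a way that vertices at cyclic distance at most `k` receive different colours. -/
structure IsChordTotalColoring (k : ℕ) (S : Set ℕ) (M : ℕ) (f : ZMod n → ℕ)
    (F : ℕ → ZMod n → ℕ) : Prop where
  vertex_lt : ∀ v, f v < M
  vertex_ne : ∀ d ∈ Set.Icc 1 k, ∀ v : ZMod n, f v ≠ f (v + d)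
  chords : IsChordColoring S M F
  left_ne : ∀ d ∈ S, ∀ v, f v ≠ F d v
  right_ne : ∀ d ∈ S, ∀ v, f (v + d) ≠ F d v

lemma IsChordColoring.of_ne {S : Set ℕ} {M : ℕ} {F : ℕ → ZMod n → ℕ}
    (hlt : ∀ d ∈ S, ∀ v, F d v < M)
    (hout : ∀ d ∈ S, ∀ d' ∈ S, ∀ v, F d v = F d' v → d = d')
    (hin : ∀ d ∈ S, ∀ d' ∈ S, ∀ v, F d (v - d) = F d' (v - d') → d = d')
    (hmix : ∀ d ∈ S, ∀ d' ∈ S, ∀ v, F d v ≠ F d' (v - d')) : IsChordColoring S M F := by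
  refine ⟨hlt, fun v => ?_⟩
  rintro ⟨d, b⟩ hd ⟨d', b'⟩ hd' h
  cases b <;> cases b' <;> simp only [chordsAt, if_true, if_false, Bool.false_eq_true] at h
  · rw [hin d hd d' hd' v h]
  · exact absurd h.symm (hmix d' hd' d hd v)
  · exact absurd h (hmix d hd d' hd' v)
  · rw [hout d hd d' hd' v h]

lemma IsChordColoring.mono {S S' : Set ℕ} {M : ℕ} {F : ℕ → ZMod n → ℕ}
    (h : IsChordColoring S M F) (hS : S' ⊆ S) : IsChordColoring S' M F :=
  ⟨fun d hd => h.1 d (hS hd), fun v => (h.2 v).mono fun _ hp => hS hp⟩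

/-- Two chord colourings with disjoint palettes combine. -/
lemma IsChordColoring.union {S T : Set ℕ} [DecidablePred (· ∈ S)] {M N : ℕ}
    {F G : ℕ → ZMod n → ℕ} (hF : IsChordColoring S M F) (hG : IsChordColoring T N G) :
    IsChordColoring (S ∪ T) (M + N) fun d v => if d ∈ S then F d v else M + G d v := by
  have hat : ∀ v (p : ℕ × Bool), chordsAt (fun d v => if d ∈ S then F d v else M + G d v) v p
      = if p.1 ∈ S then chordsAt F v p else M + chordsAt G v p := by
    rintro v ⟨d, b⟩
    cases b <;> by_cases hd : d ∈ S <;> simp [chordsAt, hd]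
  have hFlt : ∀ v (p : ℕ × Bool), p.1 ∈ S → chordsAt F v p < M := by
    rintro v ⟨d, b⟩ hd
    cases b <;> simp only [chordsAt, if_true, if_false, Bool.false_eq_true] <;> exact hF.1 d hd _
  have hmem : ∀ {d}, d ∈ S ∪ T → d ∉ S → d ∈ T := fun h h' => h.resolve_left h'
  refine ⟨fun d hd v => ?_, fun v p hp q hq h => ?_⟩
  · by_cases hS : d ∈ S
    · simp only [hS, if_true]
      have := hF.1 d hS v
      omega
    · simp only [hS, if_false]
      have := hG.1 d (hmem hd hS) v
      omega
  · rw [hat, hat] at h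
    by_cases h1 : p.1 ∈ S <;> by_cases h2 : q.1 ∈ S <;> simp only [h1, h2, if_true, if_false] at h
    · exact hF.2 v h1 h2 h
    · have := hFlt v p h1
      omega
    · have := hFlt v q h2
      omega
    · exact hG.2 v (hmem hp h1) (hmem hq h2) (Nat.add_left_cancel h)

lemma IsChordTotalColoring.union {k : ℕ} {S T : Set ℕ} [DecidablePred (· ∈ S)] {M N : ℕ}
    {f : ZMod n → ℕ} {F G : ℕ → ZMod n → ℕ} (hF : IsChordTotalColoring k S M f F)
    (hG : IsChordColoring T N G) :
    IsChordTotalColoring k (S ∪ T) (M + N) f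
      fun d v => if d ∈ S then F d v else M + G d v where
  vertex_lt v := by have := hF.vertex_lt v; omega
  vertex_ne := hF.vertex_ne
  chords := hF.chords.union hG
  left_ne d _ v := by
    by_cases hS : d ∈ S
    · simp only [hS, if_true]; exact hF.left_ne d hS v
    · simp only [hS, if_false]
      have := hF.vertex_lt v
      omega
  right_ne d _ v := by
    by_cases hS : d ∈ S
    · simp only [hS, if_true]; exact hF.right_ne d hS v
    · simp only [hS, if_false]
      have := hF.vertex_lt (v + d)
      omega

lemma natCast_ne_natCast_of_lt {a b : ℕ} (ha : a < n) (hb : b < n) (hab : a ≠ b) :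
    (a : ZMod n) ≠ b := by
  intro h
  rw [ZMod.natCast_eq_natCast_iff'] at h
  rw [Nat.mod_eq_of_lt ha, Nat.mod_eq_of_lt hb] at h
  exact hab h

/-- Distinct chords at a vertex, of length at most `k < n / 2`, have distinct other ends. -/
lemma chord_end_injOn {k : ℕ} (hkn : 2 * k < n) (v : ZMod n) :
    Set.InjOn (fun p : ℕ × Bool => if p.2 then v + p.1 else v - p.1)
      {p | p.1 ∈ Set.Icc 1 k} := by
  have hsum : ∀ d ∈ Set.Icc 1 k, ∀ d' ∈ Set.Icc 1 k, v + (d : ZMod n) ≠ v - (d' : ZMod n) := by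
    rintro d ⟨h1, h2⟩ d' ⟨h3, h4⟩ h
    have h0 : ((d + d' : ℕ) : ZMod n) = (0 : ℕ) := by
      push_cast
      linear_combination h
    exact natCast_ne_natCast_of_lt (by omega) (by omega) (by omega) h0
  have heq : ∀ d ∈ Set.Icc 1 k, ∀ d' ∈ Set.Icc 1 k, (d : ZMod n) = (d' : ZMod n) → d = d' := by
    rintro d ⟨h1, h2⟩ d' ⟨h3, h4⟩ h
    by_contra hne
    exact natCast_ne_natCast_of_lt (by omega) (by omega) hne h
  rintro ⟨d, b⟩ hd ⟨d', b'⟩ hd' h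
  cases b <;> cases b' <;> simp only [if_true, if_false, Bool.false_eq_true] at h
  · rw [heq d hd d' hd' (sub_right_injective h)]
  · exact absurd h.symm (hsum d' hd' d hd)
  · exact absurd h (hsum d hd d' hd')
  · rw [heq d hd d' hd' (add_left_cancel h)]

lemma powerOfCycle_adj_iff {k : ℕ} (hkn : 2 * k < n) {u v : ZMod n} :
    (powerOfCycle n k).Adj u v ↔
      ∃ p : ℕ × Bool, p.1 ∈ Set.Icc 1 k ∧ v = if p.2 then u + p.1 else u - p.1 := by
  simp only [powerOfCycle, circulantGraph_adj, Set.mem_ofPred_eq]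
  constructor
  · rintro ⟨-, ⟨d, h1, h2, h | h⟩ | ⟨d, h1, h2, h | h⟩⟩
    · exact ⟨(d, false), ⟨h1, h2⟩, by simp [← h]⟩
    · exact ⟨(d, true), ⟨h1, h2⟩, by simp only [if_true]; linear_combination -h⟩
    · exact ⟨(d, true), ⟨h1, h2⟩, by simp [← h]⟩
    · exact ⟨(d, false), ⟨h1, h2⟩, by
        simp only [if_false, Bool.false_eq_true]; linear_combination h⟩
  · rintro ⟨⟨d, b⟩, ⟨h1, h2⟩, rfl⟩
    have h0 : (d : ZMod n) ≠ 0 := by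
      have := natCast_ne_natCast_of_lt (n := n) (a := d) (b := 0) (by simp at h2; omega) (by omega)
        (by simp at h1; omega)
      simpa using this
    cases b
    · refine ⟨by simpa [eq_sub_iff_add_eq] using h0, Or.inl ⟨d, h1, h2, Or.inl ?_⟩⟩
      simp
    · refine ⟨by simpa using h0, Or.inr ⟨d, h1, h2, Or.inl ?_⟩⟩
      simp

/-- A total colouring of the vertices and chords of lengths `1, …, k` is one of the power of
cycle. -/
theorem IsChordTotalColoring.totalColorable {k M : ℕ} {S : Set ℕ} {f : ZMod n → ℕ}
    {F : ℕ → ZMod n → ℕ} (h : IsChordTotalColoring k S M f F) (hS : Set.Icc 1 k ⊆ S)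
    (hkn : 2 * k < n) : (powerOfCycle n k).TotalColorable M := by
  classical
  have : NeZero n := ⟨by omega⟩
  have hval : ∀ u v : ZMod n, u ≠ v → (v - u).val + (u - v).val = n := by
    intro u v huv
    have : NeZero (v - u) := ⟨sub_ne_zero.2 huv.symm⟩
    have h1 := ZMod.val_neg_of_ne_zero (v - u)
    rw [neg_sub] at h1
    have := ZMod.val_lt (v - u)
    omega
  let c₀ : ZMod n → ZMod n → ℕ := fun u v =>
    if (v - u).val ≤ k then F (v - u).val u else
      if (u - v).val ≤ k then F (u - v).val v else 0
  have hc₀ : ∀ u v, c₀ u v = c₀ v u := by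
    intro u v
    by_cases huv : u = v
    · rw [huv]
    have := hval u v huv
    by_cases h1 : (v - u).val ≤ k
    · have h2 : ¬ (u - v).val ≤ k := by omega
      simp [c₀, h1, h2]
    · by_cases h2 : (u - v).val ≤ k <;> simp [c₀, h1, h2]
  let E : Sym2 (ZMod n) → ℕ := Sym2.lift ⟨c₀, hc₀⟩
  have hEright : ∀ d ∈ Set.Icc 1 k, ∀ v, E s(v, v + d) = F d v := by
    rintro d ⟨-, hd⟩ v
    have h1 : (v + d - v).val = d := by
      rw [add_sub_cancel_left, ZMod.val_natCast, Nat.mod_eq_of_lt (by omega)]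
    change c₀ v (v + d) = F d v
    simp only [c₀, h1, hd, if_true]
  have hE : ∀ v, ∀ p : ℕ × Bool, p.1 ∈ Set.Icc 1 k →
      E s(v, if p.2 then v + p.1 else v - p.1) = chordsAt F v p := by
    rintro v ⟨d, b⟩ hd
    cases b
    · have := hEright d hd (v - d)
      rw [sub_add_cancel, Sym2.eq_swap] at this
      simpa [chordsAt] using this
    · simpa [chordsAt] using hEright d hd v
  have hElt : ∀ e ∈ (powerOfCycle n k).edgeSet, E e < M := by
    intro e he
    induction e with
    | _ u v =>
    obtain ⟨⟨d, b⟩, hp, rfl⟩ := (powerOfCycle_adj_iff hkn).1 ((mem_edgeSet _).1 he)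
    rw [hE u _ hp]
    cases b <;> simp only [chordsAt, if_true, if_false, Bool.false_eq_true] <;>
      exact h.chords.1 d (hS hp) _
  refine ⟨Sum.elim (fun v => ⟨f v, h.vertex_lt v⟩) (fun e => ⟨E e, hElt e e.2⟩), ?_, ?_, ?_⟩
  · intro u v huv heq
    simp only [Sum.elim_inl, Fin.mk.injEq] at heq
    obtain ⟨⟨d, b⟩, hp, rfl⟩ := (powerOfCycle_adj_iff hkn).1 huv
    cases b
    · have := h.vertex_ne d hp (u - d)
      rw [sub_add_cancel] at this
      exact this heq.symm
    · exact h.vertex_ne d hp u heq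
  · rintro ⟨e, he⟩ ⟨e', he'⟩ v hne hve hve' heq
    simp only [Sum.elim_inr, Fin.mk.injEq] at heq
    obtain ⟨w, rfl⟩ := Sym2.mem_iff_exists.1 hve
    obtain ⟨w', rfl⟩ := Sym2.mem_iff_exists.1 hve'
    obtain ⟨p, hp, rfl⟩ := (powerOfCycle_adj_iff hkn).1 ((mem_edgeSet _).1 he)
    obtain ⟨p', hp', rfl⟩ := (powerOfCycle_adj_iff hkn).1 ((mem_edgeSet _).1 he')
    rw [hE v p hp, hE v p' hp'] at heq
    have := h.chords.2 v (hS hp) (hS hp') heq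
    subst this
    exact hne rfl
  · rintro v ⟨e, he⟩ hve heq
    simp only [Sum.elim_inl, Sum.elim_inr, Fin.mk.injEq] at heq
    obtain ⟨w, rfl⟩ := Sym2.mem_iff_exists.1 hve
    obtain ⟨⟨d, b⟩, hp, rfl⟩ := (powerOfCycle_adj_iff hkn).1 ((mem_edgeSet _).1 he)
    rw [hE v _ hp] at heq
    cases b
    · have := h.right_ne d (hS hp) (v - d)
      rw [sub_add_cancel] at this
      exact this heq
    · exact h.left_ne d (hS hp) v heq

end Chords

/-! ### The maximum degree -/

lemma TotalColorable.degree_add_one_le {V : Type*} {G : SimpleGraph V} {m : ℕ} (h : G.TotalColorable m)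
    (v : V) [Fintype (G.neighborSet v)] : G.degree v + 1 ≤ m := by
  obtain ⟨c, hc⟩ := h
  let g : Option (G.neighborSet v) → Fin m
    | none => c (Sum.inl v)
    | some w => c (Sum.inr ⟨s(v, w), w.2⟩)
  have hg : Function.Injective g := by
    rintro (_ | w) (_ | w') h
    · rfl
    · exact absurd h (hc.incident_ne v _ (Sym2.mem_mk_left _ _))
    · exact absurd h.symm (hc.incident_ne v _ (Sym2.mem_mk_left _ _))
    · by_contra hne
      refine hc.edge_ne ⟨s(v, w), w.2⟩ ⟨s(v, w'), w'.2⟩ v ?_ (Sym2.mem_mk_left _ _)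
        (Sym2.mem_mk_left _ _) h
      intro h'
      exact hne (congrArg some (Subtype.ext (Sym2.congr_right.1 (congrArg Subtype.val h'))))
  have := Fintype.card_le_of_injective g hg
  rwa [Fintype.card_option, Fintype.card_fin, card_neighborSet_eq_degree] at this

lemma two_mul_le_maxDegree_powerOfCycle {n k : ℕ} [NeZero n] (hkn : 2 * k < n)
    [DecidableRel (powerOfCycle n k).Adj] : 2 * k ≤ (powerOfCycle n k).maxDegree := by
  refine le_trans ?_ ((powerOfCycle n k).degree_le_maxDegree 0)
  have hinj := chord_end_injOn hkn (0 : ZMod n)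
  rw [← card_neighborFinset_eq_degree]
  have : 2 * k = ((Finset.Icc 1 k) ×ˢ (Finset.univ : Finset Bool)).card := by
    simp [mul_comm]
  rw [this]
  refine Finset.card_le_card_of_injOn _ ?_ (hinj.mono ?_)
  · intro p hp
    have hp' : p.1 ∈ Set.Icc 1 k := by simpa using hp
    simp only [Finset.mem_coe, mem_neighborFinset]
    exact (powerOfCycle_adj_iff hkn).2 ⟨p, hp', rfl⟩
  · intro p hp
    simpa using hp

section Circulant

variable {n : ℕ}

/-! ### Edge colourings of circulant graphs -/

lemma zmod_val_add_natCast [NeZero n] (x : ZMod n) {c : ℕ} (hc : c < n) :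
    (x + (c : ZMod n)).val = if x.val + c < n then x.val + c else x.val + c - n := by
  have hx := ZMod.val_lt x
  rw [ZMod.val_add, ZMod.val_natCast, Nat.mod_eq_of_lt hc]
  split_ifs with h
  · exact Nat.mod_eq_of_lt h
  · rw [Nat.mod_eq_sub_mod (by omega), Nat.mod_eq_of_lt (by omega)]

lemma zmod_val_sub_natCast [NeZero n] (x : ZMod n) {c : ℕ} (hc : c < n) :
    (x - (c : ZMod n)).val = if c ≤ x.val then x.val - c else x.val + n - c := by
  have h := zmod_val_add_natCast (x - (c : ZMod n)) hc
  rw [sub_add_cancel] at h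
  have h1 := ZMod.val_lt (x - (c : ZMod n))
  have h2 := ZMod.val_lt x
  split_ifs at h ⊢ <;> omega

/-- Vizing's theorem for the circulant graph with connection set `{±a, …, ±k}`. -/
lemma exists_isChordColoring_vizing {a k : ℕ} (ha : 1 ≤ a) (hkn : 2 * k < n) :
    ∃ F : ℕ → ZMod n → ℕ, IsChordColoring (Set.Icc a k) (2 * (k + 1 - a) + 1) F := by
  classical
  have : NeZero n := ⟨by omega⟩
  have hsub : ∀ {d}, d ∈ Set.Icc a k → d ∈ Set.Icc 1 k := fun h => ⟨ha.trans h.1, h.2⟩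
  let e : ZMod n → ℕ × Bool → ZMod n := fun u p => if p.2 then u + p.1 else u - p.1
  let G : SimpleGraph (ZMod n) :=
    { Adj := fun u v => ∃ p : ℕ × Bool, p.1 ∈ Set.Icc a k ∧ v = e u p
      symm := by
        constructor
        rintro u v ⟨⟨d, b⟩, hp, rfl⟩
        refine ⟨(d, !b), hp, ?_⟩
        cases b <;> simp [e]
      loopless := by
        constructor
        rintro u ⟨p, hp, hu⟩
        exact ((powerOfCycle_adj_iff hkn).2 ⟨p, hsub hp, hu⟩).ne rfl }
  have hdeg : ∀ v, (G.neighborSet v).ncard ≤ 2 * (k + 1 - a) := by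
    intro v
    have h1 : G.neighborSet v ⊆ ((Finset.Icc a k ×ˢ (Finset.univ : Finset Bool)).image (e v) :
        Finset (ZMod n)) := by
      rintro w ⟨p, hp, rfl⟩
      refine Finset.mem_coe.2 (Finset.mem_image_of_mem _ ?_)
      simpa using hp
    refine (Set.ncard_le_ncard h1 (Finset.finite_toSet _)).trans ?_
    rw [Set.ncard_coe_finset]
    refine Finset.card_image_le.trans ?_
    simp [mul_comm]
  obtain ⟨c, hc⟩ := exists_isEdgeColoring _ G hdeg
  refine ⟨fun d v => c s(v, v + d), fun d _ v => (c s(v, v + d)).2, fun v p hp q hq h => ?_⟩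
  have hat : ∀ p : ℕ × Bool,
      chordsAt (fun d v => ((c s(v, v + (d : ZMod n)) : ℕ))) v p = c s(v, e v p) := by
    rintro ⟨d, b⟩
    cases b
    · simp only [chordsAt, e, if_false, Bool.false_eq_true, sub_add_cancel]
      rw [Sym2.eq_swap]
    · simp [chordsAt, e]
  rw [hat, hat] at h
  exact chord_end_injOn hkn v (hsub hp) (hsub hq) (hc ⟨p, hp, rfl⟩ ⟨q, hq, rfl⟩ (Fin.ext h))

/-- For even `n` the chords of odd lengths in `[b, k]` join vertices of different parity, so two
colours for each length suffice. -/
lemma exists_isChordColoring_odd (hn : Even n) (b : ℕ) {k : ℕ} (hkn : k < n) :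
    ∃ F : ℕ → ZMod n → ℕ,
      IsChordColoring {d | Odd d ∧ d ∈ Set.Icc b k} (2 * ((k + 2 - b) / 2)) F := by
  have : NeZero n := ⟨by omega⟩
  refine ⟨fun d v => 2 * ((d - b) / 2) + v.val % 2, IsChordColoring.of_ne ?_ ?_ ?_ ?_⟩
  · rintro d ⟨-, h1, h2⟩ v
    omega
  · rintro d ⟨hd, h1, h2⟩ d' ⟨hd', h1', h2'⟩ v h
    rw [Nat.odd_iff] at hd hd'
    omega
  · rintro d ⟨hd, h1, h2⟩ d' ⟨hd', h1', h2'⟩ v h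
    rw [Nat.odd_iff] at hd hd'
    omega
  · rintro d ⟨hd, h1, h2⟩ d' ⟨hd', h1', h2'⟩ v h
    rw [Nat.odd_iff] at hd hd'
    rw [Nat.even_iff] at hn
    rw [zmod_val_sub_natCast v (by omega : d' < n)] at h
    split_ifs at h <;> omega

/-- Colours `0, 1, 2` for the chords of length `D` on `0, …, n - 1`: the chord from `p` to
`p + D` alternates between `0` and `1` with the block `⌊p / D⌋`; a chord passing through `0` gets
`1` if that continues the alternation and `2` otherwise. -/
def longChord (n D p : ℕ) : ℕ :=
  if p < n - D then p / D % 2 else if p / D % 2 = 1 then 1 else 2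

/-- The colour of the rung `{e, e + 1}`, `e` even: `2`, unless the chords of length `D` that use
the colour `2` meet the rung. -/
def rung (n D e : ℕ) : ℕ :=
  if n - D ≤ e ∧ e / D % 2 = 0 then 0 else
    if e < D ∧ (e + n - D) / D % 2 = 0 then 1 else 2

lemma longChord_rung {D p q e : ℕ} (hn : Even n) (hD : Even D) (hD0 : 0 < D) (hDn : 2 * D < n)
    (hp : p < n) (he : e = 2 * (p / 2)) (hq : q = if D ≤ p then p - D else p + n - D) :
    longChord n D p ≠ longChord n D q ∧ longChord n D p ≠ rung n D e ∧
      longChord n D q ≠ rung n D e ∧ longChord n D p < 3 ∧ longChord n D q < 3 ∧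
      rung n D e < 3 := by
  obtain ⟨N, rfl⟩ := hn
  obtain ⟨E, rfl⟩ := hD
  have hdiv : ∀ x, 2 * (x / 2) / (E + E) = x / (E + E) := by
    intro x
    rw [← two_mul, Nat.mul_div_mul_left _ _ (by norm_num), Nat.div_div_eq_div_mul]
  have heD : e / (E + E) = p / (E + E) := by rw [he, hdiv]
  by_cases h : E + E ≤ p
  · have hq' : q / (E + E) + 1 = p / (E + E) := by
      rw [hq, if_pos h, Nat.div_eq_sub_div (by omega) h]
    rw [if_pos h] at hq
    have h1 : ¬ e < E + E := by omega
    have h2 : N + N - (E + E) ≤ e ↔ ¬ p < N + N - (E + E) := by omega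
    have h3 : q < N + N - (E + E) := by omega
    simp only [longChord, rung, heD, h1, h2, h3, false_and, if_true, if_false]
    split_ifs <;> omega
  · rw [if_neg h] at hq
    have hp0 : p / (E + E) = 0 := Nat.div_eq_of_lt (by omega)
    have heq : (e + (N + N) - (E + E)) / (E + E) = q / (E + E) := by
      rw [← hdiv q]; congr 1; omega
    have h1 : e < E + E := by omega
    have h2 : ¬ N + N - (E + E) ≤ e := by omega
    have h3 : ¬ q < N + N - (E + E) := by omega
    have h4 : p < N + N - (E + E) := by omega
    simp only [longChord, rung, heq, hp0, h1, h2, h3, h4, false_and, true_and, if_true, if_false]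
    split_ifs <;> omega

/-- For even `n` and `D`, the chords of lengths `D - 1` and `D` need only four colours. After the
odd vertices are translated by `D`, the chords of length `D - 1` become the rungs `{e, e + 1}` and
the chords `{e, e + 2D - 1}`, with `e` even; the latter form a perfect matching, which has its own
colour. The cycles of chords of length `D` are coloured alternately around the circle; where an odd
cycle forces a third colour, it does so on two parallel chords joined by two rungs, and these rungs
take the colours that became free. -/
lemma exists_isChordColoring_pair {D : ℕ} (hn : Even n) (hD : Even D) (hD0 : 0 < D)
    (hDn : 2 * D < n) :
    ∃ F : ℕ → ZMod n → ℕ, IsChordColoring {D - 1, D} 4 F := by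
  have : NeZero n := ⟨by omega⟩
  let P : ZMod n → ℕ := fun x => if x.val % 2 = 0 then x.val else (x + (D : ZMod n)).val
  let F₁ : ZMod n → ℕ := fun x => longChord n D (P x)
  let F₂ : ZMod n → ℕ := fun x =>
    if x.val % 2 = 0 then 3 else rung n D (x + ((D - 1 : ℕ) : ZMod n)).val
  have hnn := Nat.even_iff.1 hn
  have hDD := Nat.even_iff.1 hD
  have key : ∀ v : ZMod n,
      F₁ v ≠ F₁ (v - (D : ZMod n)) ∧ F₁ v ≠ F₂ v ∧ F₁ v ≠ F₂ (v - ((D - 1 : ℕ) : ZMod n)) ∧ F₁ (v - (D : ZMod n)) ≠ F₂ v ∧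
      F₁ (v - (D : ZMod n)) ≠ F₂ (v - ((D - 1 : ℕ) : ZMod n)) ∧ F₂ v ≠ F₂ (v - ((D - 1 : ℕ) : ZMod n)) ∧ F₁ v < 4 ∧ F₂ v < 4 := by
    intro v
    have hv := ZMod.val_lt v
    have hsD := zmod_val_sub_natCast v (c := D) (by omega)
    have hs1 := zmod_val_sub_natCast v (c := D - 1) (by omega)
    have haD := zmod_val_add_natCast v (c := D) (by omega)
    have ha1 := zmod_val_add_natCast v (c := D - 1) (by omega)
    have hpar : (v - (D : ZMod n)).val % 2 = v.val % 2 := by split_ifs at hsD <;> omega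
    have hpar1 : (v - ((D - 1 : ℕ) : ZMod n)).val % 2 = 1 - v.val % 2 := by split_ifs at hs1 <;> omega
    rcases Nat.mod_two_eq_zero_or_one v.val with h | h
    · obtain ⟨k1, k2, k3, k4, k5, k6⟩ := longChord_rung (p := v.val) (q := (v - (D : ZMod n)).val)
        (e := v.val) hn hD hD0 hDn hv (by omega) hsD
      have e1 : F₁ v = longChord n D v.val := by simp [F₁, P, h]
      have e2 : F₁ (v - (D : ZMod n)) = longChord n D (v - (D : ZMod n)).val := by simp [F₁, P, h, hpar]
      have e3 : F₂ v = 3 := by simp [F₂, h]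
      have e4 : F₂ (v - ((D - 1 : ℕ) : ZMod n)) = rung n D v.val := by
        simp only [F₂, hpar1, h, sub_add_cancel]; simp
      rw [e1, e2, e3, e4]
      refine ⟨k1, ?_, k2, ?_, k3, ?_, ?_, ?_⟩ <;> omega
    · have hv' := ZMod.val_lt (v + (D : ZMod n))
      have hq : v.val = if D ≤ (v + (D : ZMod n)).val then (v + (D : ZMod n)).val - D
          else (v + (D : ZMod n)).val + n - D := by
        split_ifs at haD ⊢ <;> omega
      obtain ⟨k1, k2, k3, k4, k5, k6⟩ := longChord_rung (p := (v + (D : ZMod n)).val) (q := v.val)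
        (e := (v + ((D - 1 : ℕ) : ZMod n)).val) hn hD hD0 hDn hv'
        (by split_ifs at haD ha1 <;> omega) hq
      have e1 : F₁ v = longChord n D (v + (D : ZMod n)).val := by simp [F₁, P, h]
      have e2 : F₁ (v - (D : ZMod n)) = longChord n D v.val := by simp [F₁, P, h, hpar]
      have e3 : F₂ v = rung n D (v + ((D - 1 : ℕ) : ZMod n)).val := by simp [F₂, h]
      have e4 : F₂ (v - ((D - 1 : ℕ) : ZMod n)) = 3 := by simp only [F₂, hpar1, h]; simp
      rw [e1, e2, e3, e4]
      refine ⟨k1, k2, ?_, k3, ?_, ?_, ?_, ?_⟩ <;> omega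
  have hne : D - 1 ≠ D := by omega
  refine ⟨fun d v => if d = D then F₁ v else F₂ v, IsChordColoring.of_ne ?_ ?_ ?_ ?_⟩
  · rintro d - v
    obtain ⟨-, -, -, -, -, -, h1, h2⟩ := key v
    split_ifs <;> assumption
  · rintro d (rfl | rfl) d' (rfl | rfl) v h <;> simp only [hne, if_true, if_false] at h ⊢
    · exact absurd h.symm (key v).2.1
    · exact absurd h (key v).2.1
  · rintro d (rfl | rfl) d' (rfl | rfl) v h <;> simp only [hne, if_true, if_false] at h ⊢
    · exact absurd h.symm (key v).2.2.2.2.1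
    · exact absurd h (key v).2.2.2.2.1
  · rintro d (rfl | rfl) d' (rfl | rfl) v <;> simp only [hne, if_true, if_false]
    · exact (key v).2.2.2.2.2.1
    · exact (key v).2.2.2.1.symm
    · exact (key v).2.2.1
    · exact (key v).1

/-- For even `n`, the circulant graph with connection set `{±a, …, ±k}`, `a` odd, is of class 1:
each even length is paired with the odd length before it. -/
lemma exists_isChordColoring_Icc (hn : Even n) {a : ℕ} (ha : Odd a) (k : ℕ) (hkn : 2 * k < n) :
    ∃ F : ℕ → ZMod n → ℕ, IsChordColoring (Set.Icc a k) (2 * (k + 1 - a)) F := by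
  classical
  induction k using Nat.strong_induction_on with
  | _ k ih =>
  have ha' := Nat.odd_iff.1 ha
  rcases Nat.lt_or_ge k a with hka | hka
  · refine ⟨fun _ _ => 0, ?_⟩
    rw [Set.Icc_eq_empty (by omega)]
    exact ⟨fun d hd => hd.elim, fun v p hp => hp.elim⟩
  rcases Nat.even_or_odd k with hk | hk
  · have hk' := Nat.even_iff.1 hk
    obtain ⟨F, hF⟩ := ih (k - 2) (by omega) (by omega)
    obtain ⟨G, hG⟩ := exists_isChordColoring_pair hn hk (by omega) hkn
    have h := hF.union hG
    rw [show 2 * (k - 2 + 1 - a) + 4 = 2 * (k + 1 - a) by omega] at h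
    refine ⟨_, h.mono ?_⟩
    rintro d ⟨h1, h2⟩
    simp only [Set.mem_union, Set.mem_Icc, Set.mem_insert_iff, Set.mem_singleton_iff]
    omega
  · have hk' := Nat.odd_iff.1 hk
    obtain ⟨F, hF⟩ := ih (k - 1) (by omega) (by omega)
    obtain ⟨G, hG⟩ := exists_isChordColoring_odd hn k (k := k) (by omega)
    have h := hF.union hG
    rw [show 2 * (k - 1 + 1 - a) + 2 * ((k + 2 - k) / 2) = 2 * (k + 1 - a) by omega] at h
    refine ⟨_, h.mono ?_⟩
    rintro d ⟨h1, h2⟩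
    rcases Nat.lt_or_ge d k with h | h
    · exact Or.inl ⟨h1, by omega⟩
    · obtain rfl : d = k := by omega
      exact Or.inr ⟨hk, le_rfl, le_rfl⟩

end Circulant

section Base

variable {n : ℕ}

/-! ### Lifting total colourings of complete graphs -/

lemma natCast_eq_natCast_of_lt {m a b : ℕ} (ha : a < m) (hb : b < m)
    (h : (a : ZMod m) = b) : a = b := by
  by_contra hne
  exact natCast_ne_natCast_of_lt ha hb hne h

lemma natCast_add_natCast_ne_zero {m a b : ℕ} (ha : a < m) (hb : b < m) (ha0 : 0 < a)
    (hab : a + b ≠ m) : (a : ZMod m) + b ≠ 0 := by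
  intro h
  have h' : ((a + b : ℕ) : ZMod m) = 0 := by push_cast; exact h
  rw [ZMod.natCast_eq_zero_iff] at h'
  obtain ⟨t, ht⟩ := h'
  rcases t with _ | _ | t
  · omega
  · omega
  · have : m * 2 ≤ m * (t + 1 + 1) := Nat.mul_le_mul_left _ (by omega)
    omega

/-- The chord `{x, y}` gets the colour `x + y` in `ℤ/mℤ`; this is proper as long as no two
lengths add up to `m`. -/
lemma isChordColoring_sum {m : ℕ} [NeZero m] (hdvd : m ∣ n) {S : Set ℕ}
    (hS : ∀ d ∈ S, 0 < d ∧ d < m) (hadd : ∀ d ∈ S, ∀ d' ∈ S, d + d' ≠ m) :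
    IsChordColoring S m fun d (v : ZMod n) =>
      (2 * ZMod.castHom hdvd (ZMod m) v + (d : ZMod m)).val := by
  refine IsChordColoring.of_ne (fun d _ v => ZMod.val_lt _) ?_ ?_ ?_
  · intro d hd d' hd' v h
    exact natCast_eq_natCast_of_lt (hS d hd).2 (hS d' hd').2
      (add_left_cancel (ZMod.val_injective m h))
  · intro d hd d' hd' v h
    have h := ZMod.val_injective m h
    simp only [map_sub, map_natCast] at h
    exact natCast_eq_natCast_of_lt (hS d hd).2 (hS d' hd').2 (by linear_combination -h)
  · intro d hd d' hd' v h
    have h := ZMod.val_injective m h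
    simp only [map_sub, map_natCast] at h
    exact natCast_add_natCast_ne_zero (hS d hd).2 (hS d' hd').2 (hS d hd).1 (hadd d hd d' hd')
      (by linear_combination h)

/-- For odd `m`, the canonical total colouring of `K_m` with `m` colours, in which `x` has the
colour `2x` and `{x, y}` the colour `x + y`, lifts to the chords of a set of lengths that are
distinct and nonzero in `ℤ/mℤ` up to sign. -/
lemma isChordTotalColoring_of_odd {m k : ℕ} [NeZero m] (hdvd : m ∣ n) (hm : Odd m) (hkm : k < m)
    {S : Set ℕ} (hS : ∀ d ∈ S, 0 < d ∧ d < m) (hadd : ∀ d ∈ S, ∀ d' ∈ S, d + d' ≠ m) :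
    IsChordTotalColoring k S m
      (fun v : ZMod n => (2 * ZMod.castHom hdvd (ZMod m) v).val)
      (fun d v => (2 * ZMod.castHom hdvd (ZMod m) v + (d : ZMod m)).val) where
  vertex_lt v := ZMod.val_lt _
  vertex_ne := by
    rintro d ⟨h1, h2⟩ v h
    have h := ZMod.val_injective m h
    simp only [map_add, map_natCast] at h
    have hm' := Nat.odd_iff.1 hm
    exact natCast_add_natCast_ne_zero (m := m) (a := d) (b := d) (by omega) (by omega) h1 (by omega)
      (by linear_combination -h)
  chords := isChordColoring_sum hdvd hS hadd
  left_ne := by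
    intro d hd v h
    have h := ZMod.val_injective m h
    refine natCast_ne_natCast_of_lt (hS d hd).2 (b := 0) ((Nat.zero_le d).trans_lt (hS d hd).2)
      (hS d hd).1.ne' ?_
    push_cast
    linear_combination -h
  right_ne := by
    intro d hd v h
    have h := ZMod.val_injective m h
    simp only [map_add, map_natCast] at h
    refine natCast_ne_natCast_of_lt (hS d hd).2 (b := 0) ((Nat.zero_le d).trans_lt (hS d hd).2)
      (hS d hd).1.ne' ?_
    push_cast
    linear_combination h

/-- For odd `h`, a total colouring with `2h` colours of `K_{2h}` without the perfect matching
`{x, x + h}`: the colours `2x` and `2x + h` are both free at `x` and at `x + h`, and have different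
parities. It lifts to the chords of lengths `1, …, h - 1`. -/
lemma exists_isChordTotalColoring_of_odd_half {h k : ℕ} (hdvd : 2 * h ∣ n) (hh : Odd h)
    (hkm : k < 2 * h) :
    ∃ (f : ZMod n → ℕ) (F : ℕ → ZMod n → ℕ),
      IsChordTotalColoring k (Set.Icc 1 (h - 1)) (2 * h) f F := by
  have hh' := Nat.odd_iff.1 hh
  have : NeZero (2 * h) := ⟨by omega⟩
  let r : ZMod n → ZMod (2 * h) := fun v => ZMod.castHom hdvd (ZMod (2 * h)) v
  have hradd : ∀ v (d : ℕ), r (v + d) = r v + d := fun v d => by simp only [r, map_add, map_natCast]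
  -- the two free colours at `v`, told apart by the residue of `v`
  let t : ZMod n → ℕ := fun v => if (r v).val < h then 0 else h
  have ht : ∀ v, t v = 0 ∨ t v = h := fun v => by
    by_cases h0 : (r v).val < h
    · exact Or.inl (if_pos h0)
    · exact Or.inr (if_neg h0)
  have hS : ∀ d ∈ Set.Icc 1 (h - 1), 0 < d ∧ d < 2 * h := by
    rintro d ⟨h1, h2⟩
    omega
  have hne : ∀ d ∈ Set.Icc 1 (h - 1), ∀ v, (t v : ZMod (2 * h)) ≠ d ∧
      (t v : ZMod (2 * h)) + d ≠ 0 := by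
    rintro d ⟨h1, h2⟩ v
    have := ht v
    refine ⟨natCast_ne_natCast_of_lt (by omega) (by omega) (by omega), fun hz => ?_⟩
    rw [add_comm] at hz
    exact natCast_add_natCast_ne_zero (a := d) (b := t v) (by omega) (by omega) (by omega)
      (by omega) hz
  refine ⟨fun v => (2 * r v + (t v : ZMod (2 * h))).val,
    fun d v => (2 * r v + (d : ZMod (2 * h))).val, ?_, ?_, ?_, ?_, ?_⟩
  · exact fun v => ZMod.val_lt _
  · rintro d ⟨h1, h2⟩ v heq
    have heq := ZMod.val_injective _ heq
    have hrv : ∀ u, (((r u).val : ℕ) : ZMod (2 * h)) = r u := fun u => ZMod.natCast_zmod_val _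
    have hcast : ((2 * (r v).val + t v : ℕ) : ZMod (2 * h))
        = ((2 * (r (v + d)).val + t (v + d) : ℕ) : ZMod (2 * h)) := by
      push_cast
      rw [hrv, hrv]; exact heq
    rw [ZMod.natCast_eq_natCast_iff'] at hcast
    have hlt1 := ZMod.val_lt (r v)
    have hlt2 := ZMod.val_lt (r (v + d))
    have hmod : ∀ x, x < 2 * (2 * (2 * h)) →
        x % (2 * h) = x ∨ x % (2 * h) + 2 * h = x ∨ x % (2 * h) + 2 * (2 * h) = x ∨
        x % (2 * h) + 3 * (2 * h) = x := by
      intro x hx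
      have h1 := Nat.mod_add_div x (2 * h)
      have h2 : x / (2 * h) < 4 := Nat.div_lt_of_lt_mul (by omega)
      interval_cases x / (2 * h) <;> omega
    have m1 := hmod (2 * (r v).val + t v) (by have := ht v; omega)
    have m2 := hmod (2 * (r (v + d)).val + t (v + d)) (by have := ht (v + d); omega)
    have hval : (r v).val = (r (v + d)).val := by
      simp only [t] at hcast m1 m2
      split_ifs at hcast m1 m2 <;> omega
    have h0 := ZMod.val_injective _ hval
    rw [hradd] at h0
    refine natCast_ne_natCast_of_lt (n := 2 * h) (a := d) (b := 0) (by omega) (by omega)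
      (by omega) ?_
    push_cast
    linear_combination -h0
  · refine isChordColoring_sum hdvd hS ?_
    rintro d ⟨h1, h2⟩ d' ⟨h3, h4⟩
    omega
  · intro d hd v heq
    exact (hne d hd v).1 (add_left_cancel (ZMod.val_injective _ heq))
  · intro d hd v heq
    have heq := ZMod.val_injective _ heq
    rw [hradd] at heq
    exact (hne d hd (v + d)).2 (by linear_combination heq)

/-- The total colouring of `K_{2h}` with `2h + 1` colours induced by the canonical one of
`K_{2h+1}` lifts to the chords of lengths `1, …, h - 1`, and to every second chord on each cycle of
chords of length `h`; one further colour suffices for the remaining chords of length `h`. -/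
lemma exists_isChordTotalColoring_half {h k : ℕ} (hdvd : 2 * h ∣ n) (hh : 0 < h)
    (hkm : k < 2 * h) :
    ∃ (f : ZMod n → ℕ) (F : ℕ → ZMod n → ℕ),
      IsChordTotalColoring k (Set.Icc 1 h) (2 * h + 2) f F := by
  have : NeZero (2 * h) := ⟨by omega⟩
  let r : ZMod n → ℕ := fun v => (ZMod.castHom hdvd (ZMod (2 * h)) v).val
  have hr : ∀ v, r v < 2 * h := fun v => ZMod.val_lt _
  have hadd : ∀ v (d : ℕ), d < 2 * h →
      r (v + d) = if r v + d < 2 * h then r v + d else r v + d - 2 * h := by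
    intro v d hd
    simp only [r, map_add, map_natCast]
    exact zmod_val_add_natCast _ hd
  have hsub : ∀ v (d : ℕ), d < 2 * h →
      r (v - d) = if d ≤ r v then r v - d else r v + 2 * h - d := by
    intro v d hd
    simp only [r, map_sub, map_natCast]
    exact zmod_val_sub_natCast _ hd
  let s : ℕ → ℕ → ℕ := fun a b => if a + b < 2 * h + 1 then a + b else a + b - (2 * h + 1)
  have hslt : ∀ a b, a < 2 * h → b < 2 * h → s a b < 2 * h + 1 := by
    intro a b ha hb
    simp only [s]
    split_ifs <;> omega
  have hscomm : ∀ a b, s a b = s b a := fun a b => by simp only [s, add_comm]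
  have hsinj : ∀ a b b', a < 2 * h → b < 2 * h → b' < 2 * h → s a b = s a b' → b = b' := by
    intro a b b' ha hb hb' heq
    simp only [s] at heq
    split_ifs at heq <;> omega
  let F : ℕ → ZMod n → ℕ := fun d v =>
    if d = h ∧ h ≤ r v then 2 * h + 1 else s (r v) (r (v + d))
  have hFin : ∀ d v, F d (v - d)
      = if d = h ∧ h ≤ r (v - d) then 2 * h + 1 else s (r v) (r (v - d)) := by
    intro d v
    simp only [F, sub_add_cancel, hscomm (r v)]
  have hne : ∀ d ∈ Set.Icc 1 h, ∀ v, r (v + d) ≠ r v ∧ r (v - d) ≠ r v := by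
    rintro d ⟨h1, h2⟩ v
    have h3 := hadd v d (by omega)
    have h4 := hsub v d (by omega)
    have := hr v
    split_ifs at h3 h4 <;> omega
  refine ⟨fun v => s (r v) (r v), F, ?_, ?_, IsChordColoring.of_ne ?_ ?_ ?_ ?_, ?_, ?_⟩
  · intro v
    have := hslt _ _ (hr v) (hr v)
    omega
  · rintro d ⟨h1, h2⟩ v heq
    have h3 := hadd v d (by omega)
    have h4 := hr v
    simp only [s] at heq
    split_ifs at h3 heq <;> omega
  · rintro d - v
    have := hslt _ _ (hr v) (hr (v + d))
    simp only [F]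
    split_ifs <;> omega
  · rintro d ⟨h1, h2⟩ d' ⟨h3, h4⟩ v heq
    simp only [F] at heq
    have l1 := hslt _ _ (hr v) (hr (v + d))
    have l2 := hslt _ _ (hr v) (hr (v + d'))
    have e1 := hadd v d (by omega)
    have e2 := hadd v d' (by omega)
    split_ifs at heq with c1 c2 c2
    · omega
    · omega
    · omega
    · have := hsinj _ _ _ (hr v) (hr _) (hr _) heq
      have := hr v
      split_ifs at e1 e2 <;> omega
  · rintro d ⟨h1, h2⟩ d' ⟨h3, h4⟩ v heq
    rw [hFin, hFin] at heq
    have l1 := hslt _ _ (hr v) (hr (v - d))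
    have l2 := hslt _ _ (hr v) (hr (v - d'))
    have e1 := hsub v d (by omega)
    have e2 := hsub v d' (by omega)
    split_ifs at heq with c1 c2 c2
    · omega
    · omega
    · omega
    · have := hsinj _ _ _ (hr v) (hr _) (hr _) heq
      have := hr v
      split_ifs at e1 e2 <;> omega
  · rintro d ⟨h1, h2⟩ d' ⟨h3, h4⟩ v heq
    rw [hFin] at heq
    simp only [F] at heq
    have l1 := hslt _ _ (hr v) (hr (v + d))
    have l2 := hslt _ _ (hr v) (hr (v - d'))
    have e1 := hadd v d (by omega)
    have e2 := hsub v d' (by omega)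
    have := hr v
    split_ifs at heq with c1 c2 c2
    · split_ifs at e2 <;> omega
    · omega
    · omega
    · have := hsinj _ _ _ (hr v) (hr _) (hr _) heq
      split_ifs at e1 e2 <;> omega
  · intro d hd v heq
    have l1 := hslt _ _ (hr v) (hr v)
    simp only [F] at heq
    split_ifs at heq with c1
    · omega
    · exact (hne d hd v).1 (hsinj _ _ _ (hr v) (hr _) (hr _) heq).symm
  · intro d hd v heq
    have l1 := hslt _ _ (hr (v + d)) (hr (v + d))
    simp only [F] at heq
    split_ifs at heq with c1
    · omega
    · rw [hscomm (r v)] at heq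
      exact (hne d hd v).1 (hsinj _ _ _ (hr _) (hr _) (hr _) heq)

end Base

/-! ### Total colourings of powers of cycles -/

lemma TotalColorable.mono {V : Type*} {G : SimpleGraph V} {m m' : ℕ} (h : G.TotalColorable m)
    (hm : m ≤ m') : G.TotalColorable m' := by
  obtain ⟨c, hc⟩ := h
  have hinj := Fin.castLE_injective hm
  exact ⟨fun x => Fin.castLE hm (c x), fun u v h => hinj.ne (hc.vertex_ne u v h),
    fun e f v h1 h2 h3 => hinj.ne (hc.edge_ne e f v h1 h2 h3),
    fun v e h => hinj.ne (hc.incident_ne v e h)⟩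

/-- Of two different lengths with sum `m` exactly one is odd, so the even lengths and the odd
lengths below `m - k` serve as representatives. -/
lemma totalColorable_powerOfCycle_of_even_of_odd {n k m : ℕ} (hkn : 2 * k < n)
    (hdvd : m ∣ n) (hkm : k < m) (hmk : m ≤ 2 * k + 1) (hn : Even n) (hm : Odd m) :
    (powerOfCycle n k).TotalColorable (2 * k + 1) := by
  classical
  have : NeZero m := ⟨by omega⟩
  have hm' := Nat.odd_iff.1 hm
  obtain ⟨F, hF⟩ := exists_isChordColoring_odd hn (m - k) (k := k) (by omega)
  have h := (isChordTotalColoring_of_odd hdvd hm hkm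
    (S := {d | d ∈ Set.Icc 1 k ∧ ¬ (Odd d ∧ m - k ≤ d)}) (fun d hd => ⟨hd.1.1, hd.1.2.trans_lt hkm⟩)
    (by
      rintro d ⟨⟨h1, h2⟩, h3⟩ d' ⟨⟨h4, h5⟩, h6⟩ heq
      rw [Nat.odd_iff] at h3 h6
      omega)).union hF
  rw [show m + 2 * ((k + 2 - (m - k)) / 2) = 2 * k + 1 by omega] at h
  refine h.totalColorable (fun d hd => ?_) hkn
  by_cases hc : Odd d ∧ m - k ≤ d
  · exact Or.inr ⟨hc.1, hc.2, hd.2⟩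
  · exact Or.inl ⟨hd, hc⟩

lemma totalColorable_powerOfCycle_of_odd {n k m : ℕ} (hkn : 2 * k < n)
    (hdvd : m ∣ n) (hkm : k < m) (hmk : m ≤ 2 * k + 1) (hm : Odd m) :
    (powerOfCycle n k).TotalColorable (2 * k + 2) := by
  classical
  have : NeZero m := ⟨by omega⟩
  have hm' := Nat.odd_iff.1 hm
  obtain ⟨F, hF⟩ := exists_isChordColoring_vizing (a := (m - 1) / 2 + 1) (by omega) hkn
  have h := (isChordTotalColoring_of_odd hdvd hm hkm (S := Set.Icc 1 ((m - 1) / 2))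
    (by rintro d ⟨h1, h2⟩; omega)
    (by rintro d ⟨h1, h2⟩ d' ⟨h3, h4⟩; omega)).union hF
  rw [show m + (2 * (k + 1 - ((m - 1) / 2 + 1)) + 1) = 2 * k + 2 by omega] at h
  refine h.totalColorable (fun d hd => ?_) hkn
  obtain ⟨h1, h2⟩ := hd
  simp only [Set.mem_union, Set.mem_Icc]
  omega

lemma totalColorable_powerOfCycle_of_even {n k m : ℕ} (hkn : 2 * k < n)
    (hdvd : m ∣ n) (hkm : k < m) (hmk : m ≤ 2 * k + 1) (hm : Even m) :
    (powerOfCycle n k).TotalColorable (2 * k + 2) := by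
  classical
  have hn : Even n := hm.trans_dvd hdvd
  obtain ⟨h, rfl⟩ := hm
  rw [← two_mul] at hdvd
  rcases Nat.even_or_odd h with hh | hh
  · obtain ⟨f, F, hF⟩ := exists_isChordTotalColoring_half hdvd (k := k) (by omega) (by omega)
    obtain ⟨G, hG⟩ := exists_isChordColoring_Icc hn hh.add_one k hkn
    have hFG := hF.union hG
    rw [show 2 * h + 2 + 2 * (k + 1 - (h + 1)) = 2 * k + 2 by omega] at hFG
    refine hFG.totalColorable (fun d hd => ?_) hkn
    obtain ⟨h1, h2⟩ := hd
    simp only [Set.mem_union, Set.mem_Icc]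
    omega
  · obtain ⟨f, F, hF⟩ := exists_isChordTotalColoring_of_odd_half hdvd hh (k := k) (by omega)
    obtain ⟨G, hG⟩ := exists_isChordColoring_Icc hn hh k hkn
    have hFG := hF.union hG
    rw [show 2 * h + 2 * (k + 1 - h) = 2 * k + 2 by omega] at hFG
    refine hFG.totalColorable (fun d hd => ?_) hkn
    obtain ⟨h1, h2⟩ := hd
    simp only [Set.mem_union, Set.mem_Icc]
    omega

end SimpleGraph

theorem theorem2p1 (n k i : ℕ) [NeZero n] (hk : 1 ≤ k) (hkn : k < n / 2)
    (hi : 1 ≤ i) (hik : i ≤ k + 1) (hdvd : k + i ∣ n)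
    [DecidableRel (SimpleGraph.powerOfCycle n k).Adj] :
    (SimpleGraph.powerOfCycle n k).totalChromaticNumber
        ≤ (((SimpleGraph.powerOfCycle n k).maxDegree + 2 : ℕ) : ℕ∞) ∧
      (Even n → Odd (k + i) →
        (SimpleGraph.powerOfCycle n k).totalChromaticNumber
          = (((SimpleGraph.powerOfCycle n k).maxDegree + 1 : ℕ) : ℕ∞)) := by
  have hkn' : 2 * k < n := by omega
  have hdeg := SimpleGraph.two_mul_le_maxDegree_powerOfCycle hkn'
  have hle : ∀ m, (SimpleGraph.powerOfCycle n k).TotalColorable m →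
      (SimpleGraph.powerOfCycle n k).totalChromaticNumber ≤ m := fun m hm => iInf₂_le m hm
  constructor
  · apply hle
    refine SimpleGraph.TotalColorable.mono (m := 2 * k + 2) ?_ (by omega)
    rcases Nat.even_or_odd (k + i) with h | h
    · exact SimpleGraph.totalColorable_powerOfCycle_of_even hkn' hdvd (by omega) (by omega) h
    · exact SimpleGraph.totalColorable_powerOfCycle_of_odd hkn' hdvd (by omega) (by omega) h
  · intro hn hodd
    apply le_antisymm
    · exact hle _ ((SimpleGraph.totalColorable_powerOfCycle_of_even_of_odd hkn' hdvd (by omega)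
        (by omega) hn hodd).mono (by omega))
    · refine le_iInf₂ fun m hm => ?_
      obtain ⟨v, hv⟩ := (SimpleGraph.powerOfCycle n k).exists_maximal_degree_vertex
      have := SimpleGraph.TotalColorable.degree_add_one_le hm v
      rw [hv]
      exact_mod_cast this
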